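/- Let $K$ be a field of characteristic $p>0$, let $K'\subseteq K$ be its prime field (the subfield of order $p$), and let $N\ge 2$. For a point $P\in\mathbb{P}^N(K)$ let $I(P)\subset K[x_0,\dots,x_N]$ be the ideal generated by all homogeneous polynomials vanishing at $P$. Fix a $K'$-point $q$ of $\mathbb{P}^N(K)$, that is, a point with homogeneous coordinates in $K'$. Let $I=\bigcap_P I(P)$, where $P$ runs over all $K'$-points of $\mathbb{P}^N(K)$ other than $q$, and let $I^{(m)}=\bigcap_P I(P)^m$ be its $m$-th symbolic power. Suppose that $p\equiv 1\pmod N$ and $p>(N-1)^2$, and put $r=(p+N-1)/N$. Then $Nr-N+1=p$ and $$I^{(p)}=I^{(Nr-N+1)}\not\subseteq I^r .$$ Moreover, there are homogeneous coordinates $y_0,\dots,y_N$ on $\mathbb{P}^N(K)$ (linearly independent linear forms in $x_0,\dots,x_N$ with coefficients in $K'$) in which $q=[1:0:\cdots:0]$, and for any such coordinates the form $$F=y_0^{N-1}\prod_{i=1}^N\bigl(y_0^{p-1}-y_i^{p-1}\bigr)\,Q_{p-1,N}\bigl(y_0^{p-1},\dots,y_N^{p-1}\bigr)$$ is homogeneous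 of degree $p(p+N-2)$, does not vanish at $q$, lies in $I^{(p)}$ and does not lie in $I^r$. Here $Q_{p-1,N}$ is the homogeneous component of degree $p-1$ of $\bigl((x_0+1)\cdots(x_N+1)\bigr)^{p-1}$. -/

import Mathlib

namespace PointIdeals

open scoped LinearAlgebra.Projectivization

/-- The projective space `ℙ^N` over `K`. -/
abbrev PSpace (K : Type*) [Field K] (N : ℕ) : Type _ :=
  ℙ K (Fin (N + 1) → K)

/-- The point `P` of `ℙ^N(K)` is a `k`-point, for a subfield `k` of `K`: it has homogeneous
coordinates that all lie in `k`. -/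
def IsRationalPoint {K : Type*} [Field K] {N : ℕ} (k : Subfield K) (P : PSpace K N) : Prop :=
  ∃ (v : Fin (N + 1) → K) (hv : v ≠ 0), (∀ i, v i ∈ k) ∧ P = Projectivization.mk K v hv

/-- The polynomial `f` vanishes at the point `P`. It is only used for homogeneous `f`, for which
the choice of homogeneous coordinates of `P` does not matter. -/
def VanishesAt {K : Type*} [Field K] {N : ℕ} (f : MvPolynomial (Fin (N + 1)) K)
    (P : PSpace K N) : Prop :=
  MvPolynomial.eval P.rep f = 0

/-- `I(P)`: the ideal generated by all homogeneous polynomials vanishing at the point `P`. -/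
noncomputable def pointIdeal {K : Type*} [Field K] {N : ℕ} (P : PSpace K N) :
    Ideal (MvPolynomial (Fin (N + 1)) K) :=
  Ideal.span {f | (∃ d : ℕ, f.IsHomogeneous d) ∧ VanishesAt f P}

/-- The ideal `I = ⋂ I(P)` of a set `S` of points of `ℙ^N(K)`. -/
noncomputable def idealOfPoints {K : Type*} [Field K] {N : ℕ} (S : Set (PSpace K N)) :
    Ideal (MvPolynomial (Fin (N + 1)) K) :=
  ⨅ P ∈ S, pointIdeal P

/-- The `m`-th symbolic power `I^(m) = ⋂ I(P)^m` of the ideal `I` of a set `S` of points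
of `ℙ^N(K)`. -/
noncomputable def symbolicPower {K : Type*} [Field K] {N : ℕ} (S : Set (PSpace K N)) (m : ℕ) :
    Ideal (MvPolynomial (Fin (N + 1)) K) :=
  ⨅ P ∈ S, pointIdeal P ^ m

/-- All points of `ℙ^N(K)` with coordinates in the prime field of `K` (which is
`⊥ : Subfield K`), except the point `q`. -/
def primePointsExcept {K : Type*} [Field K] {N : ℕ} (q : PSpace K N) : Set (PSpace K N) :=
  {P | IsRationalPoint (⊥ : Subfield K) P ∧ P ≠ q}

/-- `Q_{p-1,N}`: the homogeneous component of degree `p - 1` of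
`((x_0 + 1) ⋯ (x_N + 1))^(p-1)`. -/
noncomputable def formQ (K : Type*) [Field K] (p N : ℕ) : MvPolynomial (Fin (N + 1)) K :=
  MvPolynomial.homogeneousComponent (p - 1)
    ((∏ i : Fin (N + 1), (MvPolynomial.X i + 1)) ^ (p - 1))

/-- The form
`x_0^(N-1) * ∏_{i=1}^N (x_0^(p-1) - x_i^(p-1)) * Q_{p-1,N}(x_0^(p-1), …, x_N^(p-1))`. -/
noncomputable def formF (K : Type*) [Field K] (p N : ℕ) : MvPolynomial (Fin (N + 1)) K :=
  MvPolynomial.X 0 ^ (N - 1)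
    * (∏ i : Fin N, (MvPolynomial.X 0 ^ (p - 1) - MvPolynomial.X i.succ ^ (p - 1)))
    * MvPolynomial.aeval
        (fun i : Fin (N + 1) => (MvPolynomial.X i : MvPolynomial (Fin (N + 1)) K) ^ (p - 1))
        (formQ K p N)

/-- The `i`-th linear form `y_i = ∑_j A_{ij} x_j` of the matrix `A`. -/
noncomputable def linForm {K : Type*} [Field K] {N : ℕ}
    (A : Matrix (Fin (N + 1)) (Fin (N + 1)) K) (i : Fin (N + 1)) :
    MvPolynomial (Fin (N + 1)) K :=
  ∑ j, MvPolynomial.C (A i j) * MvPolynomial.X j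

/-- The linear forms `y_0, …, y_N` of `A` are homogeneous coordinates defined over the prime field
in which `q` is the point `[1 : 0 : ⋯ : 0]`. -/
def IsAdapted {K : Type*} [Field K] {N : ℕ}
    (A : Matrix (Fin (N + 1)) (Fin (N + 1)) K) (q : PSpace K N) : Prop :=
  (∀ i j, A i j ∈ (⊥ : Subfield K)) ∧ IsUnit A.det ∧ ∀ i, i ≠ 0 → VanishesAt (linForm A i) q

end PointIdeals

/-! Two estimates on the form F are played off against each other. Upper bound at `q`: a form of
degree at most N(p-1) that vanishes at every prime-field point except `q` also vanishes at `q`, by a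
Chevalley–Warning count (`eval_eq_zero_of_degree_le`). Hence every element of I, restricted to the
affine line over `q` with parameter t, is divisible by t^(N(p-1)+1), and every element of I^r by its
r-th power. F is nonzero at `q` and its degree p(p+N-2) is less than r(N(p-1)+1), so F is not in I^r
(`vanishesAt_of_mem_pow`). Multiplicity elsewhere: let s coordinates y_i be nonzero at P ≠ q. If s ≥
2, the Q-factor has multiplicity at least p-s+1 at P, by Frobenius (`aeval_formQ_mem`). If y_0 ≠ 0,
then s-1 of the binomials vanish at P; if y_0 = 0, then s ≤ N and y_0^(N-1) contributes N-1. Either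
way the total is at least p. If s = 1, then y_0 = 0 and some binomial has multiplicity p-1
(`formF_mem_symbolicPower`). -/

namespace PointIdeals

open MvPolynomial

/-! ### Homogeneous components and the order of vanishing of Q. -/

section Graded

variable {K R σ : Type*} [Field K] [CommRing R] [Algebra K R]

/-- Substituting `u_i t` for the variables separates the homogeneous components by powers of `t`. -/
lemma coeff_aeval_C_mul_X (u : σ → R) (f : MvPolynomial σ K) (n : ℕ) :
    (aeval (fun i => Polynomial.C (u i) * Polynomial.X) f).coeff n =
      aeval u (homogeneousComponent n f) := by
  induction f using MvPolynomial.induction_on' with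
  | monomial d a =>
    have h : aeval (fun i => Polynomial.C (u i) * Polynomial.X) (monomial d a) =
        Polynomial.C (aeval u (monomial d a)) * Polynomial.X ^ d.degree := by
      rw [aeval_monomial, aeval_monomial, Polynomial.algebraMap_apply, map_mul, mul_assoc]
      congr 1
      simp only [Finsupp.prod, mul_pow, Finset.prod_mul_distrib, map_prod, map_pow]
      rw [Finset.prod_pow_eq_pow_sum]
      rfl
    rw [h, Polynomial.coeff_C_mul_X_pow,
      homogeneousComponent_of_mem (isHomogeneous_monomial a rfl)]
    split_ifs <;> simp
  | add f g hf hg => rw [map_add, Polynomial.coeff_add, hf, hg, map_add, map_add]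

lemma aeval_sub_aeval_mem {I : Ideal R} {u v : σ → R} (h : ∀ i, u i - v i ∈ I)
    (f : MvPolynomial σ K) : aeval u f - aeval v f ∈ I := by
  rw [← Ideal.Quotient.eq, ← Ideal.Quotient.mkₐ_eq_mk K, comp_aeval_apply, comp_aeval_apply]
  congr 2
  funext i
  exact Ideal.Quotient.eq.2 (h i)

lemma aeval_formQ (p N : ℕ) (u : Fin (N + 1) → R) :
    aeval u (formQ K p N) =
      ((∏ i, (1 + Polynomial.C (u i) * Polynomial.X)) ^ (p - 1)).coeff (p - 1) := by
  rw [formQ, ← coeff_aeval_C_mul_X]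
  simp [add_comm]

/-- A product of `M` binomials `1 + (w + z_i) t` with `z_i ∈ J`, expanded in powers of `J`. -/
lemma coeff_prod_mem {ι : Type*} (T : Finset ι) (w : R) (z : ι → R) {J : Ideal R}
    (hz : ∀ i ∈ T, z i ∈ J) (n m : ℕ)
    (h : ∀ k < m, k ≤ T.card → k ≤ n →
      ((1 + Polynomial.C w * Polynomial.X) ^ (T.card - k)).coeff (n - k) = 0) :
    (∏ i ∈ T, (1 + Polynomial.C (w + z i) * Polynomial.X)).coeff n ∈ J ^ m := by
  classical
  have h1 : ∀ i, 1 + Polynomial.C (w + z i) * Polynomial.X =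
      (1 + Polynomial.C w * Polynomial.X) + Polynomial.C (z i) * Polynomial.X := by
    intro i; rw [map_add]; ring
  simp only [h1]
  -- The subset U collects the factors contributing 1 + wt. The other k factors contribute z_i t:
  -- they put the term in J^k and shift the degree by k, so `h` kills it when k < m.
  rw [Finset.prod_add, Polynomial.finsetSum_coeff]
  refine Ideal.sum_mem _ fun U hU => ?_
  rw [Finset.mem_powerset] at hU
  rw [Finset.prod_const, Finset.prod_mul_distrib, Finset.prod_const, ← map_prod, mul_left_comm,
    Polynomial.coeff_C_mul, Polynomial.coeff_mul_X_pow']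
  have hc : (T \ U).card + U.card = T.card := Finset.card_sdiff_add_card_eq_card hU
  have hmem : ∏ i ∈ T \ U, z i ∈ J ^ (T \ U).card := by
    rw [← Finset.prod_const]
    exact Ideal.prod_mem_prod fun i hi => hz i (Finset.mem_sdiff.1 hi).1
  by_cases hk : (T \ U).card < m
  · split_ifs with hn
    · have := h _ hk (by omega) hn
      rw [show T.card - (T \ U).card = U.card by omega] at this
      rw [this, mul_zero]
      exact zero_mem _
    · rw [mul_zero]; exact zero_mem _
  · exact Ideal.mul_mem_right _ _ (Ideal.pow_le_pow_right (not_lt.1 hk) hmem)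

/-- By Frobenius the power equals (1 + w^p t^p)^a (1 + wt)^b, which has no terms in degrees strictly
between b and p. -/
lemma coeff_one_add_pow_eq_zero {p : ℕ} (hp : p.Prime) [CharP R p] (w : R) {a b n : ℕ}
    (hbn : b < n) (hn : n < p) :
    ((1 + Polynomial.C w * Polynomial.X) ^ (a * p + b)).coeff n = 0 := by
  have : Fact p.Prime := ⟨hp⟩
  have hc : (1 + Polynomial.C w * Polynomial.X) ^ (a * p + b) =
      Polynomial.expand R p ((1 + Polynomial.C (w ^ p) * Polynomial.X) ^ a) *
        (1 + Polynomial.C w * Polynomial.X) ^ b := by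
    rw [pow_add, mul_comm a p, pow_mul, add_pow_char]
    simp [mul_pow]
  rw [hc, Polynomial.coeff_mul]
  refine Finset.sum_eq_zero fun ⟨i, j⟩ hij => ?_
  rw [Finset.HasAntidiagonal.mem_antidiagonal] at hij
  simp only at hij ⊢
  rw [Polynomial.coeff_expand hp.pos]
  split_ifs with hd
  · have hi : i = 0 := Nat.eq_zero_of_dvd_of_lt hd (by omega)
    have hdeg : ((1 + Polynomial.C w * Polynomial.X) ^ b).natDegree ≤ b := by
      refine Polynomial.natDegree_pow_le.trans ((Nat.mul_le_mul_left b ?_).trans_eq (mul_one b))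
      compute_degree
    rw [Polynomial.coeff_eq_zero_of_natDegree_lt (p := _ ^ b) (by omega), mul_zero]
  · rw [zero_mul]

/-- If `s` of the `u_i` agree modulo `J` and the others are small, then `Q_{p-1,N}(u)` lies in
`J^(p-s+1)`. -/
lemma aeval_formQ_mem {p N : ℕ} (hp : p.Prime) [CharP R p] {J : Ideal R}
    (u : Fin (N + 1) → R) (S : Finset (Fin (N + 1))) (hS : 2 ≤ S.card) (hSp : S.card ≤ p)
    (h1 : ∀ i ∈ S, ∀ j ∈ S, u i - u j ∈ J) (h2 : ∀ j ∉ S, u j ∈ J ^ (p - S.card + 1)) :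
    aeval u (formQ K p N) ∈ J ^ (p - S.card + 1) := by
  classical
  -- The small u_j may be replaced by 0, which leaves only s(p-1) binomials, where s = |S|.
  have h0 : aeval u (formQ K p N) - aeval (fun i => if i ∈ S then u i else 0) (formQ K p N) ∈
      J ^ (p - S.card + 1) := by
    refine aeval_sub_aeval_mem (fun i => ?_) _
    split_ifs with hi
    · simp
    · simpa using h2 i hi
  rw [← sub_add_cancel (aeval u (formQ K p N))
    (aeval (fun i => if i ∈ S then u i else 0) (formQ K p N))]
  refine Ideal.add_mem _ h0 ?_
  obtain ⟨i₀, hi₀⟩ : S.Nonempty := Finset.card_pos.1 (by omega)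
  have hprod : (∏ i, (1 + Polynomial.C (if i ∈ S then u i else 0) * Polynomial.X)) ^ (p - 1) =
      ∏ x ∈ S ×ˢ (Finset.univ : Finset (Fin (p - 1))),
        (1 + Polynomial.C (u i₀ + (u x.1 - u i₀)) * Polynomial.X) := by
    rw [Finset.prod_product]
    simp only [Finset.prod_const, Finset.card_univ, Fintype.card_fin, Finset.prod_pow]
    congr 1
    rw [← Finset.prod_subset S.subset_univ]
    · exact Finset.prod_congr rfl fun i hi => by simp [hi]
    · intro i _ hi; simp [hi]
  rw [aeval_formQ, hprod]
  refine coeff_prod_mem _ _ _ (fun x hx => h1 _ (Finset.mem_product.1 hx).1 _ hi₀) _ _ ?_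
  intro k hk _ _
  -- With k ≤ p-s, the remainder p-s-k is below the target degree p-1-k exactly because s ≥ 2.
  have hcard : (S ×ˢ (Finset.univ : Finset (Fin (p - 1)))).card - k =
      (S.card - 1) * p + (p - S.card - k) := by
    rw [Finset.card_product, Finset.card_univ, Fintype.card_fin]
    obtain ⟨s, hs⟩ : ∃ s, S.card = s + 2 := ⟨S.card - 2, by omega⟩
    obtain ⟨e, he⟩ : ∃ e, p = s + 2 + k + e := ⟨p - (s + 2) - k, by omega⟩
    rw [hs, show p - 1 = s + 1 + k + e by omega, show p - (s + 2) - k = e by omega,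
      show s + 2 - 1 = s + 1 by omega, he]
    apply Nat.sub_eq_of_eq_add
    ring
  rw [hcard]
  exact coeff_one_add_pow_eq_zero hp _ (by omega) (by have := hp.two_le; omega)

/-- Only the top coefficient of (1 + u_0 t)^(p-1) remains. This gives the value of Q at `q`. -/
lemma aeval_formQ_of_eq_zero (p N : ℕ) (u : Fin (N + 1) → R) (h : ∀ i, i ≠ 0 → u i = 0) :
    aeval u (formQ K p N) = u 0 ^ (p - 1) := by
  rw [aeval_formQ, Fin.prod_univ_succ]
  simp only [h _ (Fin.succ_ne_zero _), map_zero, zero_mul, add_zero, Finset.prod_const_one, mul_one]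
  have := Polynomial.coeff_one_add_X_pow R (p - 1) (p - 1)
  have hc : (1 + Polynomial.C (u 0) * Polynomial.X) ^ (p - 1) =
      ((1 + Polynomial.X : Polynomial R) ^ (p - 1)).comp (Polynomial.C (u 0) * Polynomial.X) := by
    simp
  rw [hc, Polynomial.comp_C_mul_X_coeff, this, Nat.choose_self, Nat.cast_one, one_mul]

end Graded

/-! ### Forms vanishing at all prime-field points but one. -/

section Points

variable {K : Type*} [Field K] {N : ℕ}

lemma eval_smul_of_isHomogeneous {σ : Type*} {f : MvPolynomial σ K} {d : ℕ}
    (hf : f.IsHomogeneous d) (c : K) (v : σ → K) : eval (c • v) f = c ^ d * eval v f := by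
  rw [eval_eq, eval_eq, Finset.mul_sum]
  refine Finset.sum_congr rfl fun m hm => ?_
  have hd : m.degree = d := by
    rw [Finsupp.degree_eq_weight_one]; exact hf (mem_support_iff.1 hm)
  simp only [Pi.smul_apply, smul_eq_mul, mul_pow, Finset.prod_mul_distrib]
  rw [Finset.prod_pow_eq_pow_sum, ← hd, Finsupp.degree_apply]
  ring

lemma vanishesAt_mk_iff {f : MvPolynomial (Fin (N + 1)) K} {d : ℕ} (hf : f.IsHomogeneous d)
    (v : Fin (N + 1) → K) (hv : v ≠ 0) :
    VanishesAt f (Projectivization.mk K v hv) ↔ eval v f = 0 := by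
  obtain ⟨c, hc⟩ := Projectivization.exists_smul_eq_mk_rep K v hv
  rw [VanishesAt, ← hc, Units.smul_def, eval_smul_of_isHomogeneous hf]
  simp

lemma vanishesAt_homogeneousComponent {P : PSpace K N} {f : MvPolynomial (Fin (N + 1)) K}
    (hf : f ∈ pointIdeal P) (d : ℕ) : VanishesAt (homogeneousComponent d f) P := by
  -- The homogeneous generators vanish on the whole line over P, so every element of the ideal does,
  -- and the powers of t then separate its components.
  have hle : pointIdeal P ≤
      RingHom.ker (aeval (R := K) fun i => Polynomial.C (P.rep i) * Polynomial.X) := by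
    refine Ideal.span_le.2 ?_
    rintro g ⟨⟨e, he⟩, hg⟩
    rw [SetLike.mem_coe, RingHom.mem_ker]
    ext n
    rw [coeff_aeval_C_mul_X, homogeneousComponent_of_mem he]
    split_ifs
    · rw [aeval_eq_eval, Polynomial.coeff_zero]; exact hg
    · simp
  have h := coeff_aeval_C_mul_X P.rep f d
  rw [RingHom.mem_ker.1 (hle hf), aeval_eq_eval] at h
  exact h.symm

variable {p : ℕ} [Fact p.Prime] [CharP K p]

/-- The sum is linear in `f`, so the coefficients in K do no harm: it suffices to treat monomials,
which are defined over `ZMod p`. -/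
lemma sum_eval_primeField_eq_zero {σ : Type*} [Fintype σ] [DecidableEq σ]
    (f : MvPolynomial σ K)
    (h : f.totalDegree < (p - 1) * Fintype.card σ) :
    ∑ v : σ → ZMod p, eval (fun i => ZMod.castHom (dvd_refl p) K (v i)) f = 0 := by
  simp only [eval_eq]
  rw [Finset.sum_comm]
  refine Finset.sum_eq_zero fun m hm => ?_
  rw [← Finset.mul_sum]
  have h0 := MvPolynomial.sum_eval_eq_zero (monomial m (1 : ZMod p)) (by
    rw [totalDegree_monomial _ one_ne_zero, ZMod.card]
    exact (le_totalDegree hm).trans_lt h)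
  have h1 := congrArg (ZMod.castHom (dvd_refl p) K) h0
  rw [map_sum, map_zero] at h1
  convert mul_zero _
  rw [← h1]
  refine Finset.sum_congr rfl fun v _ => ?_
  rw [eval_monomial, one_mul, Finsupp.prod, map_prod]
  simp only [map_pow]

/-- A form of degree at most `N(p-1)` vanishing at all points over the prime field but one
vanishes at that point as well. -/
lemma eval_eq_zero_of_degree_le {f : MvPolynomial (Fin (N + 1)) K} {d : ℕ}
    (hf : f.IsHomogeneous d) (hN : N ≠ 0) (hd : d ≤ N * (p - 1)) {w : Fin (N + 1) → ZMod p}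
    (hw : w ≠ 0)
    (h : ∀ v : Fin (N + 1) → ZMod p, v ≠ 0 → (∀ c : ZMod p, c • w ≠ v) →
      eval (fun i => ZMod.castHom (dvd_refl p) K (v i)) f = 0) :
    eval (fun i => ZMod.castHom (dvd_refl p) K (w i)) f = 0 := by
  have hp := (Fact.out : p.Prime).two_le
  obtain ⟨i₀, hi₀⟩ := Function.ne_iff.1 hw
  rw [Pi.zero_apply] at hi₀
  set ι := ZMod.castHom (dvd_refl p) K with hι
  -- Padding by a coordinate nonzero at `w` makes the degree a positive multiple of p-1, still below
  -- (N+1)(p-1). So `g` vanishes at the origin and is constant on the p-1 nonzero multiples of `w`.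
  set g := f * X i₀ ^ (N * (p - 1) - d) with hg
  have hgh : g.IsHomogeneous (N * (p - 1)) := by
    have := hf.mul (isHomogeneous_X_pow (R := K) i₀ (N * (p - 1) - d))
    rwa [Nat.add_sub_cancel' hd] at this
  have hpos : N * (p - 1) ≠ 0 := mul_ne_zero hN (by omega)
  have hsum : ∑ v : Fin (N + 1) → ZMod p, eval (fun i => ι (v i)) g = 0 := by
    refine sum_eval_primeField_eq_zero g (hgh.totalDegree_le.trans_lt ?_)
    rw [Fintype.card_fin, mul_comm]
    exact Nat.mul_lt_mul_of_pos_left (by omega) (by omega)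
  have hsmul : ∀ c : ZMod p, eval (fun i => ι ((c • w) i)) g =
      ι c ^ (N * (p - 1)) * eval (fun i => ι (w i)) g := by
    intro c
    rw [← eval_smul_of_isHomogeneous hgh]
    congr 2
    funext i
    simp
  have hline : ∑ c : (ZMod p)ˣ, eval (fun i => ι (w i)) g =
      ∑ v : Fin (N + 1) → ZMod p, eval (fun i => ι (v i)) g := by
    refine Finset.sum_of_injOn (fun c : (ZMod p)ˣ => (c : ZMod p) • w) ?_ (by simp) ?_ ?_
    · intro a _ b _ hab
      have := congrFun hab i₀
      simp only [Pi.smul_apply, smul_eq_mul] at this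
      exact Units.ext (mul_right_cancel₀ hi₀ this)
    · intro v _ hv
      by_cases hv0 : v = 0
      · have := hsmul 0
        rw [map_zero, zero_pow hpos, zero_mul, zero_smul] at this
        rw [hv0, this]
      · rw [hg, map_mul, h v hv0, zero_mul]
        intro c hc
        refine hv ⟨Units.mk0 c ?_, by simp, hc⟩
        rintro rfl
        exact hv0 (by rw [← hc, zero_smul])
    · intro c _
      rw [hsmul, mul_comm N, pow_mul, ← map_pow, ZMod.pow_card_sub_one_eq_one c.ne_zero]
      simp
  -- The p-1 equal terms sum to -g(w) in characteristic p.
  rw [hsum, Finset.sum_const, Finset.card_univ, ZMod.card_units, nsmul_eq_mul,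
    Nat.cast_sub (by omega), CharP.cast_eq_zero, hg, map_mul, map_pow, eval_X] at hline
  simpa [hi₀] using hline

variable (p) in
lemma exists_zmod_coordinates {v : Fin (N + 1) → K} (hv : ∀ i, v i ∈ (⊥ : Subfield K)) :
    ∃ w : Fin (N + 1) → ZMod p, (fun i => ZMod.castHom (dvd_refl p) K (w i)) = v := by
  have h : ∀ i, ∃ c : ZMod p, ZMod.castHom (dvd_refl p) K c = v i := fun i => by
    rw [← RingHom.mem_fieldRange, ZMod.fieldRange_castHom_eq_bot]
    exact hv i
  choose w hw using h
  exact ⟨w, funext hw⟩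

lemma zmod_castHom_mem_bot (c : ZMod p) : ZMod.castHom (dvd_refl p) K c ∈ (⊥ : Subfield K) := by
  rw [Subfield.mem_bot_iff_pow_eq_self K p, ← map_pow, ZMod.pow_card]

variable (p) in
/-- An element of `I` restricted to the line through `q` vanishes to order `N(p-1)+1` at the
origin. -/
lemma X_pow_dvd_aeval_rep {q : PSpace K N} (hN : N ≠ 0)
    (hq : IsRationalPoint (⊥ : Subfield K) q) {f : MvPolynomial (Fin (N + 1)) K}
    (hf : f ∈ idealOfPoints (primePointsExcept q)) :
    Polynomial.X ^ (N * (p - 1) + 1) ∣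
      aeval (fun i => Polynomial.C (q.rep i) * Polynomial.X) f := by
  rw [Polynomial.X_pow_dvd_iff]
  intro d hd
  rw [coeff_aeval_C_mul_X, aeval_eq_eval]
  have hhom := homogeneousComponent_isHomogeneous d f
  change VanishesAt (homogeneousComponent d f) q
  obtain ⟨v, hv, hvk, rfl⟩ := hq
  obtain ⟨w, rfl⟩ := exists_zmod_coordinates p hvk
  rw [vanishesAt_mk_iff hhom]
  refine eval_eq_zero_of_degree_le hhom hN (by omega) (w := w) ?_ ?_
  · rintro rfl
    exact hv (by funext i; simp)
  intro u hu hne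
  have hu' : (fun i => ZMod.castHom (dvd_refl p) K (u i)) ≠ 0 := fun h => hu <| by
    funext i
    exact (map_eq_zero _).1 (congrFun h i)
  rw [← vanishesAt_mk_iff hhom _ hu']
  refine vanishesAt_homogeneousComponent ?_ d
  rw [idealOfPoints, Submodule.mem_iInf] at hf
  refine (Submodule.mem_iInf _).1 (hf _) ⟨⟨_, hu', fun i => zmod_castHom_mem_bot _, rfl⟩, ?_⟩
  rw [Ne, Projectivization.mk_eq_mk_iff']
  rintro ⟨a, ha⟩
  obtain ⟨i₀, hi₀⟩ := Function.ne_iff.1 hv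
  have hw₀ : w i₀ ≠ 0 := fun h => hi₀ (by simp [h])
  refine hne (u i₀ / w i₀) (funext fun i => (ZMod.castHom (dvd_refl p) K).injective ?_)
  have h₀ := congrFun ha i₀
  have h₁ := congrFun ha i
  simp only [Pi.smul_apply, smul_eq_mul] at h₀ h₁
  rw [Pi.smul_apply, smul_eq_mul, map_mul, map_div₀, ← h₀, ← h₁,
    mul_div_cancel_right₀ _ (by simpa using hi₀)]

variable (p) in
/-- A form of degree less than `r(N(p-1)+1)` in `I^r` vanishes at `q`. -/
lemma vanishesAt_of_mem_pow {q : PSpace K N} (hN : N ≠ 0)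
    (hq : IsRationalPoint (⊥ : Subfield K) q) {f : MvPolynomial (Fin (N + 1)) K} {d r : ℕ}
    (hd : f.IsHomogeneous d) (hdr : d < r * (N * (p - 1) + 1))
    (hf : f ∈ idealOfPoints (primePointsExcept q) ^ r) : VanishesAt f q := by
  set φ := aeval (R := K) fun i => Polynomial.C (q.rep i) * Polynomial.X
  have hle : idealOfPoints (primePointsExcept q) ≤
      (Ideal.span {Polynomial.X ^ (N * (p - 1) + 1)}).comap φ := fun g hg =>
    Ideal.mem_span_singleton.2 (X_pow_dvd_aeval_rep p hN hq hg)
  have h := Ideal.le_comap_pow _ _ (Ideal.pow_right_mono hle r hf)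
  rw [Ideal.mem_comap, Ideal.span_singleton_pow, Ideal.mem_span_singleton, ← pow_mul, mul_comm,
    Polynomial.X_pow_dvd_iff] at h
  have h0 := h d hdr
  rwa [coeff_aeval_C_mul_X, aeval_eq_eval, homogeneousComponent_of_mem hd, if_pos rfl] at h0

end Points

/-! ### Adapted coordinates and the multiplicities of F. -/

section LinearForms

variable {K : Type*} [Field K] {N : ℕ} (A : Matrix (Fin (N + 1)) (Fin (N + 1)) K)

lemma linForm_isHomogeneous (i : Fin (N + 1)) : (linForm A i).IsHomogeneous 1 :=
  IsHomogeneous.sum _ _ _ fun j _ => isHomogeneous_C_mul_X (A i j) j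

lemma eval_linForm (v : Fin (N + 1) → K) (i : Fin (N + 1)) :
    eval v (linForm A i) = A.mulVec v i := by
  simp [linForm, Matrix.mulVec, dotProduct]

lemma aeval_linForm_formF (p : ℕ) :
    aeval (linForm A) (formF K p N) = linForm A 0 ^ (N - 1) *
      (∏ i : Fin N, (linForm A 0 ^ (p - 1) - linForm A i.succ ^ (p - 1))) *
      aeval (fun i => linForm A i ^ (p - 1)) (formQ K p N) := by
  rw [formF, map_mul, map_mul, map_prod, comp_aeval_apply]
  simp

lemma aeval_linForm_formF_isHomogeneous {p : ℕ} (hp : 2 ≤ p) (hN : 2 ≤ N) :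
    (aeval (linForm A) (formF K p N)).IsHomogeneous (p * (p + N - 2)) := by
  have h1 := fun i (n : ℕ) => (linForm_isHomogeneous A i).pow n
  have h2 : (∏ i : Fin N, (linForm A 0 ^ (p - 1) - linForm A i.succ ^ (p - 1))).IsHomogeneous
      (∑ _i : Fin N, 1 * (p - 1)) :=
    IsHomogeneous.prod _ _ _ fun i _ => (h1 0 _).sub (h1 i.succ _)
  have h3 : (aeval (fun i => linForm A i ^ (p - 1)) (formQ K p N)).IsHomogeneous
      (1 * (p - 1) * (p - 1)) :=
    (homogeneousComponent_isHomogeneous _ _).aeval _ fun i => h1 i _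
  rw [aeval_linForm_formF]
  convert ((h1 0 (N - 1)).mul h2).mul h3 using 1
  obtain ⟨a, rfl⟩ := Nat.exists_eq_add_of_le hp
  obtain ⟨b, rfl⟩ := Nat.exists_eq_add_of_le hN
  rw [Finset.sum_const, Finset.card_univ, Fintype.card_fin, smul_eq_mul,
    show 2 + a - 1 = a + 1 by omega, show 2 + b - 1 = b + 1 by omega,
    show 2 + a + (2 + b) - 2 = a + b + 2 by omega]
  ring

variable {A} {q : PSpace K N}

lemma mulVec_injective_of_isUnit_det (hA : IsUnit A.det) : Function.Injective A.mulVec :=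
  Matrix.mulVec_injective_iff_isUnit.2 ((Matrix.isUnit_iff_isUnit_det A).2 hA)

lemma IsAdapted.mulVec_rep_eq_zero (hA : IsAdapted A q) {i : Fin (N + 1)} (hi : i ≠ 0) :
    A.mulVec q.rep i = 0 := by
  rw [← eval_linForm]
  exact hA.2.2 i hi

lemma IsAdapted.mulVec_rep_zero_ne_zero (hA : IsAdapted A q) : A.mulVec q.rep 0 ≠ 0 := by
  intro h
  refine q.rep_nonzero (mulVec_injective_of_isUnit_det hA.2.1 ?_)
  rw [Matrix.mulVec_zero]
  funext i
  by_cases hi : i = 0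
  · rw [hi, h, Pi.zero_apply]
  · rw [hA.mulVec_rep_eq_zero hi, Pi.zero_apply]

/-- At `q` every factor of F reduces to a power of y_0, which is nonzero there. -/
lemma not_vanishesAt_formF {p : ℕ} (hp : 2 ≤ p) (hA : IsAdapted A q) :
    ¬ VanishesAt (aeval (linForm A) (formF K p N)) q := by
  have h0 : p - 1 ≠ 0 := by omega
  have hQ : eval q.rep (aeval (fun i => linForm A i ^ (p - 1)) (formQ K p N)) =
      (A.mulVec q.rep 0 ^ (p - 1)) ^ (p - 1) := by
    rw [← aeval_eq_eval, comp_aeval_apply, aeval_formQ_of_eq_zero, aeval_eq_eval]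
    · simp [eval_linForm]
    · intro i hi
      rw [aeval_eq_eval, map_pow, eval_linForm, hA.mulVec_rep_eq_zero hi,
        zero_pow h0]
  rw [VanishesAt, aeval_linForm_formF, map_mul, map_mul, hQ, map_prod]
  simp only [map_pow, map_sub, eval_linForm, hA.mulVec_rep_eq_zero (Fin.succ_ne_zero _),
    zero_pow h0, sub_zero, Finset.prod_const]
  have := hA.mulVec_rep_zero_ne_zero
  positivity

lemma linear_combination_mem_pointIdeal {v : Fin (N + 1) → K} (hv : v ≠ 0) (a b : K)
    (i j : Fin (N + 1)) (h : a * A.mulVec v i = b * A.mulVec v j) :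
    C a * linForm A i - C b * linForm A j ∈ pointIdeal (Projectivization.mk K v hv) := by
  have hh : (C a * linForm A i - C b * linForm A j).IsHomogeneous 1 :=
    ((linForm_isHomogeneous A i).C_mul a).sub ((linForm_isHomogeneous A j).C_mul b)
  refine Ideal.subset_span ⟨⟨1, hh⟩, (vanishesAt_mk_iff hh v hv).2 ?_⟩
  simp only [map_sub, map_mul, eval_C, eval_linForm, h, sub_self]

lemma linForm_mem_pointIdeal {v : Fin (N + 1) → K} (hv : v ≠ 0) {i : Fin (N + 1)}
    (h : A.mulVec v i = 0) : linForm A i ∈ pointIdeal (Projectivization.mk K v hv) := by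
  simpa using linear_combination_mem_pointIdeal hv 1 0 i i (by simp [h])

/-- The ratio c of the two coordinates lies in the prime field, so c^(p-1) = 1, and the linear form
y_i - c y_j, which vanishes at the point, divides the difference. -/
lemma pow_sub_pow_mem_pointIdeal {p : ℕ} [Fact p.Prime] [CharP K p] {v : Fin (N + 1) → K}
    (hv : v ≠ 0) (hAk : ∀ i, A.mulVec v i ∈ (⊥ : Subfield K)) {i j : Fin (N + 1)}
    (hi : A.mulVec v i ≠ 0) (hj : A.mulVec v j ≠ 0) :
    linForm A i ^ (p - 1) - linForm A j ^ (p - 1) ∈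
      pointIdeal (Projectivization.mk K v hv) := by
  have hp := (Fact.out : p.Prime).two_le
  set c := A.mulVec v i / A.mulVec v j with hc
  have hc0 : c ≠ 0 := div_ne_zero hi hj
  have hcp : c ^ (p - 1) = 1 := by
    have h := (Subfield.mem_bot_iff_pow_eq_self K p).1 (div_mem (hAk i) (hAk j))
    rw [← hc, ← Nat.sub_add_cancel (show 1 ≤ p by omega), pow_succ] at h
    exact mul_right_cancel₀ hc0 (h.trans (one_mul c).symm)
  have hm := linear_combination_mem_pointIdeal (A := A) hv 1 c i j (by
    rw [hc, one_mul, div_mul_cancel₀ _ hj])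
  rw [C_1, one_mul] at hm
  have hd := Ideal.mem_of_dvd _ (sub_dvd_pow_sub_pow _ _ (p - 1)) hm
  rwa [mul_pow, ← C_pow, hcp, C_1, one_mul] at hd

/-- The form `F` has multiplicity at least `p` at every point over the prime field except `q`. -/
lemma formF_mem_symbolicPower {p : ℕ} (hp : p.Prime) [CharP K p] (hN : 2 ≤ N) (hNp : N < p)
    (hA : IsAdapted A q) :
    aeval (linForm A) (formF K p N) ∈ symbolicPower (primePointsExcept q) p := by
  classical
  have : Fact p.Prime := ⟨hp⟩
  refine (Submodule.mem_iInf _).2 fun P => (Submodule.mem_iInf _).2 ?_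
  rintro ⟨⟨v, hv, hvk, rfl⟩, hPq⟩
  set J := pointIdeal (Projectivization.mk K v hv)
  set y := linForm A with hy
  have hAk : ∀ i, A.mulVec v i ∈ (⊥ : Subfield K) := fun i => by
    rw [Matrix.mulVec, dotProduct]
    exact sum_mem fun j _ => mul_mem (hA.1 i j) (hvk j)
  set S := Finset.univ.filter fun i => A.mulVec v i ≠ 0 with hS
  have hmem : ∀ i, i ∈ S ↔ A.mulVec v i ≠ 0 := fun i => by simp [hS]
  have hzero : ∀ i ∉ S, y i ∈ J := fun i hi =>
    linForm_mem_pointIdeal hv (not_not.1 fun h => hi ((hmem i).2 h))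
  have hone : ∀ i ∈ S, ∀ j ∈ S, y i ^ (p - 1) - y j ^ (p - 1) ∈ J := fun i hi j hj =>
    pow_sub_pow_mem_pointIdeal hv hAk ((hmem i).1 hi) ((hmem j).1 hj)
  -- Otherwise y_0 is the only possibly nonzero coordinate of P, which forces P = q.
  have hne : ∃ i ∈ S, i ≠ 0 := by
    by_contra! hcon
    have hi : ∀ i, i ≠ 0 → A.mulVec v i = 0 := fun i hi0 =>
      not_not.1 fun h => hi0 (hcon i ((hmem i).2 h))
    refine hPq ?_
    rw [← q.mk_rep, Projectivization.mk_eq_mk_iff']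
    refine ⟨A.mulVec v 0 / A.mulVec q.rep 0, mulVec_injective_of_isUnit_det hA.2.1 ?_⟩
    rw [Matrix.mulVec_smul]
    funext i
    rw [Pi.smul_apply, smul_eq_mul]
    by_cases hi0 : i = 0
    · rw [hi0, div_mul_cancel₀ _ hA.mulVec_rep_zero_ne_zero]
    · rw [hi i hi0, hA.mulVec_rep_eq_zero hi0, mul_zero]
  obtain ⟨i₁, hi₁, hi₁0⟩ := hne
  have hcard : S.card ≤ N + 1 := (Finset.card_le_univ S).trans_eq (Fintype.card_fin _)
  have hQ : 2 ≤ S.card →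
      aeval (fun i => y i ^ (p - 1)) (formQ K p N) ∈ J ^ (p - S.card + 1) := fun h2 =>
    aeval_formQ_mem hp _ S h2 (by omega) hone fun j hj =>
      Ideal.pow_le_pow_right (by omega) (Ideal.pow_mem_pow (hzero j hj) (p - 1))
  rw [aeval_linForm_formF]
  by_cases h0 : 0 ∈ S
  · have h2 : 2 ≤ S.card := Finset.one_lt_card.2 ⟨i₁, hi₁, 0, h0, hi₁0⟩
    have hprod : ∏ i : Fin N, (y 0 ^ (p - 1) - y i.succ ^ (p - 1)) ∈ J ^ (S.card - 1) := by
      set T := Finset.univ.filter fun i : Fin N => i.succ ∈ S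
      have hT : T.card = S.card - 1 := by
        have : S = insert 0 (T.map (Fin.succEmb N)) := by
          ext i
          refine Fin.cases ?_ (fun i => ?_) i <;> simp [T, h0, Fin.succ_ne_zero]
        rw [this, Finset.card_insert_of_notMem (by simp [Fin.succ_ne_zero]), Finset.card_map,
          Nat.add_sub_cancel]
      rw [← Finset.prod_sdiff T.subset_univ, ← hT, ← Finset.prod_const]
      exact Ideal.mul_mem_left _ _ (Ideal.prod_mem_prod fun i hi =>
        hone 0 h0 _ (Finset.mem_filter.1 hi).2)
    have := Ideal.mul_mem_mul hprod (hQ h2)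
    rw [← pow_add, show S.card - 1 + (p - S.card + 1) = p by omega] at this
    rw [mul_assoc]
    exact Ideal.mul_mem_left _ _ this
  · have hy0 : y 0 ^ (N - 1) ∈ J ^ (N - 1) := Ideal.pow_mem_pow (hzero 0 h0) _
    have hcard' : S.card ≤ N := by
      have := Finset.card_lt_card (Finset.ssubset_univ_iff.2 fun h : S = _ => h0 (h ▸ Finset.mem_univ _))
      rw [Finset.card_univ, Fintype.card_fin] at this
      omega
    by_cases h2 : 2 ≤ S.card
    · have := Ideal.mul_mem_mul hy0 (hQ h2)
      rw [← pow_add] at this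
      rw [mul_right_comm]
      exact Ideal.mul_mem_right _ _ (Ideal.pow_le_pow_right (by omega) this)
    · have hS1 : ∀ i ∈ S, i = i₁ := fun i hi => Finset.card_le_one.1 (by omega) i hi i₁ hi₁
      -- Since N ≥ 2, some y_j with j ≠ 0 vanishes at P together with y_0; this binomial gives p-1,
      -- and y_0^(N-1) supplies the missing 1.
      obtain ⟨j, hj⟩ : ∃ j : Fin N, j.succ ≠ i₁ := by
        by_contra! hcon
        have := (hcon ⟨0, by omega⟩).trans (hcon ⟨1, by omega⟩).symm
        simp [Fin.ext_iff] at this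
      have hjm : y 0 ^ (p - 1) - y j.succ ^ (p - 1) ∈ J ^ (p - 1) :=
        sub_mem (Ideal.pow_mem_pow (hzero 0 h0) _)
          (Ideal.pow_mem_pow (hzero _ fun h => hj (hS1 _ h)) _)
      have hprod : ∏ i : Fin N, (y 0 ^ (p - 1) - y i.succ ^ (p - 1)) ∈ J ^ (p - 1) :=
        Ideal.mem_of_dvd _ (Finset.dvd_prod_of_mem _ (Finset.mem_univ j)) hjm
      have := Ideal.mul_mem_mul hy0 hprod
      rw [← pow_add] at this
      exact Ideal.mul_mem_right _ _ (Ideal.pow_le_pow_right (by omega) this)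

lemma exists_isAdapted (hq : IsRationalPoint (⊥ : Subfield K) q) :
    ∃ A : Matrix (Fin (N + 1)) (Fin (N + 1)) K, IsAdapted A q := by
  obtain ⟨v, hv, hvk, rfl⟩ := hq
  obtain ⟨i₀, hi₀⟩ := Function.ne_iff.1 hv
  rw [Pi.zero_apply] at hi₀
  set σ := Equiv.swap 0 i₀
  have hσ : ∀ i, i ≠ 0 → σ i ≠ i₀ := fun i hi h => hi <| by
    rw [← Equiv.swap_apply_left (0 : Fin (N + 1)) i₀] at h
    exact σ.injective h
  -- With v_{i₀} ≠ 0, take y_0 = x_{i₀} and y_i = x_{σ i} - (v_{σ i}/v_{i₀}) x_{i₀} for i ≠ 0.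
  let A : Matrix (Fin (N + 1)) (Fin (N + 1)) K := Matrix.of fun i j =>
    Pi.single (M := fun _ => K) (σ i) 1 j -
      if i = 0 then 0 else v (σ i) / v i₀ * Pi.single (M := fun _ => K) i₀ 1 j
  have hA0 : ∀ u, A.mulVec u 0 = u i₀ := fun u => by
    simp [A, σ, Matrix.mulVec, dotProduct, Pi.single_apply]
  have hA : ∀ u i, i ≠ 0 → A.mulVec u i = u (σ i) - v (σ i) / v i₀ * u i₀ := fun u i hi => by
    simp [A, hi, Matrix.mulVec, dotProduct, Pi.single_apply, sub_mul, Finset.sum_sub_distrib]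
  refine ⟨A, fun i j => ?_, ?_, fun i hi => ?_⟩
  · have hs : ∀ k l, Pi.single (M := fun _ : Fin (N + 1) => K) k 1 l ∈ (⊥ : Subfield K) :=
      fun k l => by
        rw [Pi.single_apply]
        split_ifs
        exacts [one_mem _, zero_mem _]
    simp only [A, Matrix.of_apply]
    refine sub_mem (hs _ _) ?_
    split_ifs
    exacts [zero_mem _, mul_mem (div_mem (hvk _) (hvk _)) (hs _ _)]
  · rw [← Matrix.isUnit_iff_isUnit_det, ← Matrix.mulVec_injective_iff_isUnit]
    refine (injective_iff_map_eq_zero A.mulVecLin).2 fun u hu => ?_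
    rw [Matrix.mulVecLin_apply] at hu
    have h0 : u i₀ = 0 := by rw [← hA0 u, hu, Pi.zero_apply]
    have h1 : ∀ i, u (σ i) = 0 := fun i => by
      by_cases hi : i = 0
      · rw [hi, Equiv.swap_apply_left, h0]
      · have := hA u i hi
        rw [hu, h0, mul_zero, sub_zero, Pi.zero_apply] at this
        exact this.symm
    funext i
    simpa using h1 (σ.symm i)
  · rw [vanishesAt_mk_iff (linForm_isHomogeneous A i), eval_linForm, hA v i hi,
      div_mul_cancel₀ _ hi₀, sub_self]

end LinearForms

end PointIdeals

/-! ### Arithmetic of `p`, `N`, `r` and the conclusion. -/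

theorem theorem4p8 {K : Type*} [Field K] (p : ℕ) (hp : p.Prime) [CharP K p]
    (N : ℕ) (hN : 2 ≤ N) (hmod : p ≡ 1 [MOD N]) (hlarge : (N - 1) ^ 2 < p)
    (r : ℕ) (hr : r = (p + N - 1) / N)
    (q : PointIdeals.PSpace K N)
    (hq : PointIdeals.IsRationalPoint (⊥ : Subfield K) q) :
    -- the index `Nr - (N - 1)` is `p`, so that the two symbolic powers agree
    N * r - (N - 1) = p ∧
    PointIdeals.symbolicPower (PointIdeals.primePointsExcept q) p =
      PointIdeals.symbolicPower (PointIdeals.primePointsExcept q) (N * r - (N - 1)) ∧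
    -- the failure of containment
    ¬ (PointIdeals.symbolicPower (PointIdeals.primePointsExcept q) p ≤
        PointIdeals.idealOfPoints (PointIdeals.primePointsExcept q) ^ r) ∧
    -- the explicit witness, in any coordinates over the prime field with `q = [1 : 0 : ⋯ : 0]`
    (∃ A : Matrix (Fin (N + 1)) (Fin (N + 1)) K, PointIdeals.IsAdapted A q) ∧
    ∀ A : Matrix (Fin (N + 1)) (Fin (N + 1)) K, PointIdeals.IsAdapted A q →
      ∀ F : MvPolynomial (Fin (N + 1)) K,
        F = MvPolynomial.aeval (PointIdeals.linForm A) (PointIdeals.formF K p N) →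
        F.IsHomogeneous (p * (p + N - 2)) ∧
        ¬ PointIdeals.VanishesAt F q ∧
        F ∈ PointIdeals.symbolicPower (PointIdeals.primePointsExcept q) p ∧
        F ∉ PointIdeals.idealOfPoints (PointIdeals.primePointsExcept q) ^ r := by
  have hp2 := hp.two_le
  obtain ⟨k, hk⟩ : N ∣ p - 1 := (Nat.modEq_iff_dvd' hp.one_le).1 hmod.symm
  have hk0 : k ≠ 0 := by rintro rfl; omega
  have hNp : N < p := by
    have := Nat.le_mul_of_pos_right N (Nat.pos_of_ne_zero hk0)
    omega
  have hrk : r = k + 1 := by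
    rw [hr, show p + N - 1 = (k + 1) * N by rw [Nat.add_mul, mul_comm k, ← hk]; omega,
      Nat.mul_div_cancel _ (by omega)]
  have hindex : N * r - (N - 1) = p := by
    rw [hrk, Nat.mul_add, ← hk]; omega
  -- With p = Nk+1 and r = k+1 the two sides differ by k-(N-2), so the inequality says k > N-2,
  -- which is equivalent to p > (N-1)^2.
  have hdeg : p * (p + N - 2) < r * (N * (p - 1) + 1) := by
    obtain ⟨b, rfl⟩ := Nat.exists_eq_add_of_le hN
    have hpk : p = (2 + b) * k + 1 := by omega
    have hbk : b < k := by
      rw [show 2 + b - 1 = b + 1 by omega, hpk] at hlarge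
      by_contra! hcon
      nlinarith [Nat.mul_le_mul_left (2 + b) hcon]
    rw [hrk, hk, show p + (2 + b) - 2 = p + b by omega, hpk]
    linear_combination hbk
  have main : ∀ A : Matrix (Fin (N + 1)) (Fin (N + 1)) K, PointIdeals.IsAdapted A q →
      ∀ F : MvPolynomial (Fin (N + 1)) K,
        F = MvPolynomial.aeval (PointIdeals.linForm A) (PointIdeals.formF K p N) →
        F.IsHomogeneous (p * (p + N - 2)) ∧
        ¬ PointIdeals.VanishesAt F q ∧
        F ∈ PointIdeals.symbolicPower (PointIdeals.primePointsExcept q) p ∧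
        F ∉ PointIdeals.idealOfPoints (PointIdeals.primePointsExcept q) ^ r := by
    rintro A hA F rfl
    have : Fact p.Prime := ⟨hp⟩
    have hhom := PointIdeals.aeval_linForm_formF_isHomogeneous A hp2 hN
    have hnv := PointIdeals.not_vanishesAt_formF hp2 hA
    exact ⟨hhom, hnv, PointIdeals.formF_mem_symbolicPower hp hN hNp hA, fun h =>
      hnv (PointIdeals.vanishesAt_of_mem_pow p (by omega) hq hhom hdeg h)⟩
  obtain ⟨A, hA⟩ := PointIdeals.exists_isAdapted hq
  obtain ⟨-, -, hF, hF'⟩ := main A hA _ rfl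
  exact ⟨hindex, by rw [hindex], fun hle => hF' (hle hF), ⟨A, hA⟩, main⟩
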